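/- **Setting.** $L_0$ is the pure second-order language with equality (individual variables and relation variables of every arity $\ge 1$, no constants), with Henkin semantics: a structure is $\mathcal M=(M,S_1[M],S_2[M],\dots)$ with $M\neq\emptyset$ and $S_i[M]\subseteq \mathcal P(M^i)$; elements of $S_1[M]$ are called concepts. Cardinality notation ($|X|\le|Y|$, $|X|=|Y|$, and comparisons with disjoint unions $\sqcup$ and products $\times$) refers to injections and bijections belonging to $\mathcal M$; $|X|\ge\omega$ means that $\mathcal M$ contains an injection of $X$ into a proper subset of $X$, and $|X|<\omega$ is its negation. Assume that $\mathcal M$ satisfies full comprehension (all formulas, all arities, with object and relation parameters) and, for all concepts $X,Y$: - $|X|\le|Y|$ or $|Y|\le|X|$; - if $|X|,|Y|\ge\omega$ then $|X\sqcup Y|=\max(|X|,|Y|)$ and $|X\times Y|=\max(|X|,|Y|)$; - (cardinal well-foundedness schema) for each parameter-free $L_0$-formula $\Phi(X)$: if $\Phi$ holds of some concept, then there is a concept $X$ with $\Phi(X)$ such that $|X|\le|Y|$ for every concept $Y$ with $\Phi(Y)$. Write $X\boxminus Y$ if $|X|=|Y|$ and $|M-X|=|M-Y|$; $[X]_\boxminus$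 is the class of concepts $Y$ with $X\boxminus Y$. Write $|X|\trianglelefteq|Y|$ if there is a concept $Z$ that is finite in the metatheory with $|X|\le|Z\times Y|$, and $|X|\vartriangleleft|Y|$ if $|X|\trianglelefteq|Y|$ and not $|Y|\trianglelefteq|X|$. For an equivalence relation $E$ on concepts put $[X]_{E(\boxminus)}=\{Y\in[X]_\boxminus: E(X,Y)\}$. Say that $E$ is *trivial* at $[X]_\boxminus$ if $[X]_{E(\boxminus)}=[X]_\boxminus$; *separative* if $E(Y,Z)$ implies $|Y\triangle Z|\vartriangleleft|X|$ for all $Y,Z\in[X]_\boxminus$; *complementative* if $E(Y,Z)$ implies $|Y\triangle Z|\vartriangleleft|X|$ or $|M-(Y\triangle Z)|\vartriangleleft|X|$ for all $Y,Z\in[X]_\boxminus$; *properly separative* if separative and nontrivial; *properly complementative* if complementative, not separative and nontrivial. For a concept $J$ call a set $A$ *$J$-negligible* if $A=\emptyset$ or $|A|\vartriangleleft|J|$ (the clause $A=\emptyset$ matters only for $J=\emptyset$). If $E$ is properly separative at $[X]_\boxminus$, a concept $J$ is a *measure* of $E$ on $[X]_\boxminus$ if for all $Y,Z\in[X]_\boxminus$: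 $E(Y,Z)$ iff $Y\triangle Z$ is $J$-negligible. If $E$ is properly complementative there, $J$ is a *measure* if for all $Y,Z\in[X]_\boxminus$: $E(Y,Z)$ iff $Y\triangle Z$ or $M-(Y\triangle Z)$ is $J$-negligible. **Theorem.** Let $E$ be an equivalence relation on the concepts of $\mathcal M$ that is definable in $\mathcal M$ by an $L_0$-formula without parameters, and let $X$ be a concept with $\mathcal M\models|X|<\omega$ such that $E$ is nontrivial at $[X]_\boxminus$. Then: 1. $E$ is properly separative or properly complementative at $[X]_\boxminus$; 2. $\emptyset$ is a measure of $E$ on $[X]_\boxminus$, and every measure of $E$ on $[X]_\boxminus$ is finite in the metatheory; 3. consequently, $E$ is the finest possible on the slice: if $E$ is properly separative at $[X]_\boxminus$, then $[Y]_{E(\boxminus)}=\{Y\}$ for all $Y\in[X]_\boxminus$; if it is properly complementative, then $[Y]_{E(\boxminus)}=\{Y,M-Y\}$ for all $Y\in[X]_\boxminus$. -/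

import Mathlib

/-- Formulas of the pure second-order language `L₀` with equality: there are individual variables
`x₀, x₁, …` and, for every `k`, relation variables `Xᵏ₀, Xᵏ₁, …` of arity `k + 1`
(so the concept variables are those with `k = 0`).  All terms are variables. -/
inductive SOFormula : Type
  /-- the equation of two individual variables -/
  | eq (x y : ℕ) : SOFormula
  /-- the `i`-th relation variable of arity `k + 1` applied to individual variables -/
  | rel (k i : ℕ) (x : Fin (k + 1) → ℕ) : SOFormula
  /-- falsity -/
  | fls : SOFormula
  /-- implication -/
  | imp (φ ψ : SOFormula) : SOFormula
  /-- quantification over objects -/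
  | all (x : ℕ) (φ : SOFormula) : SOFormula
  /-- quantification over relations of arity `k + 1` -/
  | allRel (k i : ℕ) (φ : SOFormula) : SOFormula

/-- The individual variables that occur free in a formula. -/
def SOFormula.freeInd : SOFormula → Set ℕ
  | .eq x y => {x, y}
  | .rel _ _ x => Set.range x
  | .fls => ∅
  | .imp φ ψ => φ.freeInd ∪ ψ.freeInd
  | .all x φ => φ.freeInd \ {x}
  | .allRel _ _ φ => φ.freeInd

/-- The relation variables that occur free in a formula; `(k, i)` stands for the `i`-th relation
variable of arity `k + 1`. -/
def SOFormula.freeRel : SOFormula → Set (ℕ × ℕ)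
  | .eq _ _ => ∅
  | .rel k i _ => {(k, i)}
  | .fls => ∅
  | .imp φ ψ => φ.freeRel ∪ ψ.freeRel
  | .all _ φ => φ.freeRel
  | .allRel k i φ => φ.freeRel \ {(k, i)}

/-- A structure `(M, S₁[M], S₂[M], …)` for `L₀` (non-standard, i.e. Henkin, semantics) with
first-order domain `M`; `S k` is the set `S_{k+1}[M]` of relations of arity `k + 1`. -/
structure HenkinStructure (M : Type*) where
  S : (k : ℕ) → Set (Set (Fin (k + 1) → M))

namespace HenkinStructure

variable {M : Type*}

/-- Satisfaction; `v` assigns objects to the individual variables and `V` assigns relations to the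
relation variables.  Relation quantifiers of arity `k + 1` range over `S k`. -/
def Sat (𝓜 : HenkinStructure M) :
    SOFormula → (ℕ → M) → ((k : ℕ) → ℕ → Set (Fin (k + 1) → M)) → Prop
  | .eq x y, v, _ => v x = v y
  | .rel k i x, v, V => (fun j => v (x j)) ∈ V k i
  | .fls, _, _ => False
  | .imp φ ψ, v, V => 𝓜.Sat φ v V → 𝓜.Sat ψ v V
  | .all x φ, v, V => ∀ a : M, 𝓜.Sat φ (Function.update v x a) V
  | .allRel k i φ, v, V =>
      ∀ R ∈ 𝓜.S k, 𝓜.Sat φ v (Function.update V k (Function.update (V k) i R))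

/-- Full comprehension, for formulas with object and relation parameters: here `x` lists the
(distinct) variables that are abstracted, and the parameters are the values of the other
variables.  The parameters for the relation variables that are free in `φ` are relations of the
structure. -/
def Comprehension (𝓜 : HenkinStructure M) : Prop :=
  ∀ (φ : SOFormula) (k : ℕ) (x : Fin (k + 1) → ℕ), Function.Injective x →
    ∀ (v : ℕ → M) (V : (k : ℕ) → ℕ → Set (Fin (k + 1) → M)),
      (∀ p ∈ φ.freeRel, V p.1 p.2 ∈ 𝓜.S p.1) →
      {a : Fin (k + 1) → M | 𝓜.Sat φ (Function.extend x a v) V} ∈ 𝓜.S k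

/-- `X` is a concept of the structure. -/
def IsConcept (𝓜 : HenkinStructure M) (X : Set M) : Prop :=
  {a : Fin 1 → M | a 0 ∈ X} ∈ 𝓜.S 0

/-- The restriction of `f` to `X` is a (unary, partial) function of the structure. -/
def HasFun (𝓜 : HenkinStructure M) (X : Set M) (f : M → M) : Prop :=
  {a : Fin 2 → M | a 0 ∈ X ∧ f (a 0) = a 1} ∈ 𝓜.S 1

/-- The restriction of the pair-valued `f` to `X` is given by a ternary relation of the
structure. -/
def HasPairFun (𝓜 : HenkinStructure M) (X : Set M) (f : M → M × M) : Prop :=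
  {a : Fin 3 → M | a 0 ∈ X ∧ f (a 0) = (a 1, a 2)} ∈ 𝓜.S 2

/-- `|X| ≤ |Y|` in the structure. -/
def CardLE (𝓜 : HenkinStructure M) (X Y : Set M) : Prop :=
  ∃ f : M → M, Set.MapsTo f X Y ∧ Set.InjOn f X ∧ 𝓜.HasFun X f

/-- `|X| = |Y|` in the structure. -/
def CardEq (𝓜 : HenkinStructure M) (X Y : Set M) : Prop :=
  ∃ f : M → M, Set.BijOn f X Y ∧ 𝓜.HasFun X f

/-- `|X| ≤ |Y × Z|` in the structure. -/
def CardLEProd (𝓜 : HenkinStructure M) (X Y Z : Set M) : Prop :=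
  ∃ f : M → M × M, Set.MapsTo f X (Y ×ˢ Z) ∧ Set.InjOn f X ∧ 𝓜.HasPairFun X f

/-- `|X| = |Y × Z|` in the structure. -/
def CardEqProd (𝓜 : HenkinStructure M) (X Y Z : Set M) : Prop :=
  ∃ f : M → M × M, Set.BijOn f X (Y ×ˢ Z) ∧ 𝓜.HasPairFun X f

/-- `|X| = |Y ⊔ Z|` in the structure (disjoint union): `X` is the disjoint union of an injective
image of `Y` and an injective image of `Z`. -/
def CardEqSum (𝓜 : HenkinStructure M) (X Y Z : Set M) : Prop :=
  ∃ f g : M → M, Set.InjOn f Y ∧ Set.InjOn g Z ∧ Disjoint (f '' Y) (g '' Z) ∧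
    f '' Y ∪ g '' Z = X ∧ 𝓜.HasFun Y f ∧ 𝓜.HasFun Z g

/-- `|X| ≥ ω` in the structure: `X` is Dedekind infinite there. -/
def IsInfinite (𝓜 : HenkinStructure M) (X : Set M) : Prop :=
  ∃ f : M → M, f '' X ⊂ X ∧ Set.InjOn f X ∧ 𝓜.HasFun X f

/-- Cardinal comparability. -/
def CardinalComparability (𝓜 : HenkinStructure M) : Prop :=
  ∀ X Y, 𝓜.IsConcept X → 𝓜.IsConcept Y → 𝓜.CardLE X Y ∨ 𝓜.CardLE Y X

/-- Infinite sums are maxima: `|X ⊔ Y| = max (|X|, |Y|)`. -/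
def InfiniteSumMax (𝓜 : HenkinStructure M) : Prop :=
  ∀ X Y, 𝓜.IsConcept X → 𝓜.IsConcept Y → 𝓜.IsInfinite X → 𝓜.IsInfinite Y →
    (𝓜.CardLE X Y → 𝓜.CardEqSum Y X Y) ∧ (𝓜.CardLE Y X → 𝓜.CardEqSum X X Y)

/-- Infinite products are maxima: `|X × Y| = max (|X|, |Y|)`. -/
def InfiniteProductMax (𝓜 : HenkinStructure M) : Prop :=
  ∀ X Y, 𝓜.IsConcept X → 𝓜.IsConcept Y → 𝓜.IsInfinite X → 𝓜.IsInfinite Y →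
    (𝓜.CardLE X Y → 𝓜.CardEqProd Y X Y) ∧ (𝓜.CardLE Y X → 𝓜.CardEqProd X X Y)

/-- The assignment of `X` to the concept variable with index `0` and of `Y` to the other concept
variables (and of empty relations to the relation variables of higher arity). -/
def conceptAssignment (X Y : Set M) : (k : ℕ) → ℕ → Set (Fin (k + 1) → M)
  | 0, 0 => {a | a 0 ∈ X}
  | 0, _ + 1 => {a | a 0 ∈ Y}
  | _ + 1, _ => ∅

/-- The schema of cardinal well-foundedness: if `Φ(X)` is a formula of `L₀` without parameters
that holds of some concept, then some concept is of least cardinality among those of which `Φ`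
holds. -/
def CardinalWellFounded [Nonempty M] (𝓜 : HenkinStructure M) : Prop :=
  ∀ φ : SOFormula, φ.freeInd = ∅ → φ.freeRel ⊆ {(0, 0)} →
    (∃ X, 𝓜.IsConcept X ∧ 𝓜.Sat φ (fun _ => Classical.arbitrary M) (conceptAssignment X X)) →
    ∃ X, 𝓜.IsConcept X ∧ 𝓜.Sat φ (fun _ => Classical.arbitrary M) (conceptAssignment X X) ∧
      ∀ Y, 𝓜.IsConcept Y →
        𝓜.Sat φ (fun _ => Classical.arbitrary M) (conceptAssignment Y Y) → 𝓜.CardLE X Y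

/-- The models under consideration: full comprehension and well-behaved cardinalities. -/
structure WellBehaved [Nonempty M] (𝓜 : HenkinStructure M) : Prop where
  comprehension : 𝓜.Comprehension
  comparability : 𝓜.CardinalComparability
  sums : 𝓜.InfiniteSumMax
  products : 𝓜.InfiniteProductMax
  wellFounded : 𝓜.CardinalWellFounded

/-- The relation `E` between concepts is defined in the structure by a formula of `L₀` without
parameters. -/
def L0Definable [Nonempty M] (𝓜 : HenkinStructure M) (E : Set M → Set M → Prop) : Prop :=
  ∃ φ : SOFormula, φ.freeInd = ∅ ∧ φ.freeRel ⊆ {(0, 0), (0, 1)} ∧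
    ∀ X Y, 𝓜.IsConcept X → 𝓜.IsConcept Y →
      (E X Y ↔ 𝓜.Sat φ (fun _ => Classical.arbitrary M) (conceptAssignment X Y))

/-- `E` is an equivalence relation on the concepts of the structure. -/
structure IsEquivOnConcepts (𝓜 : HenkinStructure M) (E : Set M → Set M → Prop) : Prop where
  refl : ∀ X, 𝓜.IsConcept X → E X X
  symm : ∀ X Y, 𝓜.IsConcept X → 𝓜.IsConcept Y → E X Y → E Y X
  trans : ∀ X Y Z, 𝓜.IsConcept X → 𝓜.IsConcept Y → 𝓜.IsConcept Z → E X Y → E Y Z → E X Z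

/-- The class `[X]_⊟` of the concepts that are bicardinally equivalent to `X`. -/
def bicardClass (𝓜 : HenkinStructure M) (X : Set M) : Set (Set M) :=
  {Y | 𝓜.IsConcept Y ∧ 𝓜.CardEq X Y ∧ 𝓜.CardEq Xᶜ Yᶜ}

/-- The class `[X]_{E(⊟)} = [X]_⊟ ∩ [X]_E`. -/
def sliceClass (𝓜 : HenkinStructure M) (E : Set M → Set M → Prop) (X : Set M) : Set (Set M) :=
  {Y | Y ∈ 𝓜.bicardClass X ∧ E X Y}

/-- `|X| ⊴ |Y|`: for some `n` in the metatheory, `n × |Y| ≥ |X|` in the structure. -/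
def TriLE (𝓜 : HenkinStructure M) (X Y : Set M) : Prop :=
  ∃ Z : Set M, 𝓜.IsConcept Z ∧ Z.Finite ∧ 𝓜.CardLEProd X Z Y

/-- `|X| ◁ |Y|`. -/
def TriLT (𝓜 : HenkinStructure M) (X Y : Set M) : Prop :=
  𝓜.TriLE X Y ∧ ¬ 𝓜.TriLE Y X

/-- `E(⊟)_X` is trivial. -/
def IsTrivialAt (𝓜 : HenkinStructure M) (E : Set M → Set M → Prop) (X : Set M) : Prop :=
  𝓜.sliceClass E X = 𝓜.bicardClass X

/-- `E(⊟)_X` is separative. -/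
def IsSeparativeAt (𝓜 : HenkinStructure M) (E : Set M → Set M → Prop) (X : Set M) : Prop :=
  ∀ Y ∈ 𝓜.bicardClass X, ∀ Z ∈ 𝓜.bicardClass X, E Y Z → 𝓜.TriLT (symmDiff Y Z) X

/-- `E(⊟)_X` is complementative. -/
def IsComplementativeAt (𝓜 : HenkinStructure M) (E : Set M → Set M → Prop) (X : Set M) : Prop :=
  ∀ Y ∈ 𝓜.bicardClass X, ∀ Z ∈ 𝓜.bicardClass X, E Y Z →
    𝓜.TriLT (symmDiff Y Z) X ∨ 𝓜.TriLT (symmDiff Y Z)ᶜ X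

/-- `E(⊟)_X` is properly separative. -/
def IsProperlySeparativeAt (𝓜 : HenkinStructure M) (E : Set M → Set M → Prop) (X : Set M) : Prop :=
  𝓜.IsSeparativeAt E X ∧ ¬ 𝓜.IsTrivialAt E X

/-- `E(⊟)_X` is properly complementative. -/
def IsProperlyComplementativeAt (𝓜 : HenkinStructure M) (E : Set M → Set M → Prop)
    (X : Set M) : Prop :=
  𝓜.IsComplementativeAt E X ∧ ¬ 𝓜.IsSeparativeAt E X ∧ ¬ 𝓜.IsTrivialAt E X

/-- `A` is negligible for the measure `J`: `A = ∅` or `|A| ◁ |J|`.  For nonempty `J` this is just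
`|A| ◁ |J|`; only the empty set is negligible for `J = ∅`, where `|A| ◁ |∅|` is never true. -/
def Negligible (𝓜 : HenkinStructure M) (A J : Set M) : Prop :=
  A = ∅ ∨ 𝓜.TriLT A J

/-- The concept `J` is a measure of `E` on `[X]_⊟`, where `E(⊟)_X` is properly separative or
properly complementative. -/
def IsMeasureAt (𝓜 : HenkinStructure M) (E : Set M → Set M → Prop) (X J : Set M) : Prop :=
  𝓜.IsConcept J ∧
    ((𝓜.IsProperlySeparativeAt E X ∧
        ∀ Y ∈ 𝓜.bicardClass X, ∀ Z ∈ 𝓜.bicardClass X,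
          (E Y Z ↔ 𝓜.Negligible (symmDiff Y Z) J)) ∨
      (𝓜.IsProperlyComplementativeAt E X ∧
        ∀ Y ∈ 𝓜.bicardClass X, ∀ Z ∈ 𝓜.bicardClass X,
          (E Y Z ↔ 𝓜.Negligible (symmDiff Y Z) J ∨ 𝓜.Negligible (symmDiff Y Z)ᶜ J)))

end HenkinStructure

/-!
Comprehension closes the relations of the structure under first-order operations. Hence the
permutations of the domain whose graphs belong to the structure form a group that contains all
transpositions, the class `[X]_⊟` is the orbit of `X` under this group
(`HenkinStructure.mem_bicardClass_iff`), and, since these permutations are automorphisms, a relation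
`E` that is definable without parameters is invariant under them
(`HenkinStructure.L0Definable.image_iff`).

The rest is the argument for the primitivity of the symmetric group on `k`-element sets. Let `E`
relate two sets `Y`, `Z` of the class with `Z ≠ Y` and `Z ≠ Yᶜ`. Then some transposition fixes `Y`
and moves `Z`, so `Z` is related to a set that arises from it by exchanging one element
(`exists_swap_of_ne`), and by homogeneity all such exchanges in the class are respected by `E`
(`swapInvariant_of_swap`). It follows that `E` is trivial on the class (`equiv_of_swapInvariant`):
one passes from any member to any other by exchanges. As `X` is finite only in the sense of the
structure, the induction behind this is an application of cardinal well-foundedness. Its formula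
says of `D` that `D = Y \ Z` for some inequivalent `Y`, `Z` such that `Y` is equivalent to all sets
which differ from it by one exchange and such that `Y \ Z` and `Z \ Y` are equinumerous
(`HenkinStructure.IsGap`). A `D` of least cardinality would be nonempty, and removing a point from
it by an exchange gives another such set, so that `D` injects into a proper subset of itself; but
`D` is no larger than a subset of a copy of `X`. Comparability of cardinals and the finiteness of
`X` ensure that `Y \ Z` and `Z \ Y` are equinumerous for any two members of the class
(`exists_matches`).

So a nontrivial `E` relates only equal or complementary sets. If it relates one complementary pair,
then it relates all of them (`equiv_compl`) and is not separative, because the symmetric difference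
is the whole domain; otherwise it is equality. Both cases are measured by `∅`. An infinite measure
would make finite symmetric differences negligible, in particular that of `X` and the result of a
single exchange.
-/

namespace HenkinStructure

variable {M : Type*} {𝓜 : HenkinStructure M}

/-! ### Closure of the relations of a structure under first-order operations -/

/-- The predicate `P` on `(k + 1)`-tuples is (the membership predicate of) a relation of the
structure. -/
def IsRel (𝓜 : HenkinStructure M) (k : ℕ) (P : (Fin (k + 1) → M) → Prop) : Prop :=
  {a | P a} ∈ 𝓜.S k

theorem IsRel.congr {k : ℕ} {P Q : (Fin (k + 1) → M) → Prop} (h : 𝓜.IsRel k P)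
    (hPQ : ∀ a, P a ↔ Q a) : 𝓜.IsRel k Q := by
  have : P = Q := funext fun a => propext (hPQ a)
  exact this ▸ h

theorem isRel_false [Nonempty M] (hc : 𝓜.Comprehension) (k : ℕ) :
    𝓜.IsRel k (fun _ => False) :=
  hc .fls k (fun i => i) Fin.val_injective (fun _ => Classical.arbitrary M) (fun _ _ => ∅)
    (by simp [SOFormula.freeRel])

theorem IsRel.imp [Nonempty M] (hc : 𝓜.Comprehension) {k : ℕ} {P Q : (Fin (k + 1) → M) → Prop}
    (hP : 𝓜.IsRel k P) (hQ : 𝓜.IsRel k Q) : 𝓜.IsRel k (fun a => P a → Q a) := by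
  have h := hc (.imp (.rel k 0 fun i => i) (.rel k 1 fun i => i)) k (fun i => i)
    Fin.val_injective (fun _ => Classical.arbitrary M)
    (Function.update (fun _ _ => ∅) k fun i => if i = 0 then {a | P a} else {a | Q a})
    (by
      rintro p (rfl | rfl)
      · simpa [IsRel] using hP
      · simpa [IsRel] using hQ)
  simpa [IsRel, Sat, Fin.val_injective.extend_apply] using h

theorem IsRel.not [Nonempty M] (hc : 𝓜.Comprehension) {k : ℕ} {P : (Fin (k + 1) → M) → Prop}
    (hP : 𝓜.IsRel k P) : 𝓜.IsRel k (fun a => ¬ P a) :=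
  hP.imp hc (isRel_false hc k)

theorem IsRel.and [Nonempty M] (hc : 𝓜.Comprehension) {k : ℕ} {P Q : (Fin (k + 1) → M) → Prop}
    (hP : 𝓜.IsRel k P) (hQ : 𝓜.IsRel k Q) : 𝓜.IsRel k (fun a => P a ∧ Q a) :=
  ((hP.imp hc (hQ.not hc)).not hc).congr fun a => by tauto

theorem IsRel.or [Nonempty M] (hc : 𝓜.Comprehension) {k : ℕ} {P Q : (Fin (k + 1) → M) → Prop}
    (hP : 𝓜.IsRel k P) (hQ : 𝓜.IsRel k Q) : 𝓜.IsRel k (fun a => P a ∨ Q a) :=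
  ((hP.not hc).imp hc hQ).congr fun a => by tauto

/-- The quantified variable is the coordinate `0`, in front of the remaining ones. -/
theorem IsRel.exists [Nonempty M] (hc : 𝓜.Comprehension) {k : ℕ}
    {P : M → (Fin (k + 1) → M) → Prop}
    (hP : 𝓜.IsRel (k + 1) (fun b => P (b 0) fun j => b j.succ)) :
    𝓜.IsRel k (fun a => ∃ y, P y a) := by
  have h := hc (.all (k + 1) (.rel (k + 1) 0 (Fin.cons (k + 1) fun i => i))) k (fun i => i)
    Fin.val_injective (fun _ => Classical.arbitrary M)
    (Function.update (fun _ _ => ∅) (k + 1) fun _ => {b | ¬ P (b 0) fun j => b j.succ})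
    (by
      rintro p rfl
      simpa [IsRel] using hP.not hc)
  refine (IsRel.not hc (show 𝓜.IsRel k _ from h)).congr fun a => ?_
  have hne (j : Fin (k + 1)) : (j : ℕ) ≠ k + 1 := j.isLt.ne
  simp [Sat, Fin.val_injective.extend_apply, hne]

theorem isRel_eq [Nonempty M] (hc : 𝓜.Comprehension) {k : ℕ} (i j : Fin (k + 1)) :
    𝓜.IsRel k (fun a => a i = a j) := by
  have h := hc (.eq i j) k (fun i => i) Fin.val_injective (fun _ => Classical.arbitrary M)
    (fun _ _ => ∅) (by simp [SOFormula.freeRel])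
  simpa [IsRel, Sat, Fin.val_injective.extend_apply] using h

theorem isRel_eq_const (hc : 𝓜.Comprehension) {k : ℕ} (i : Fin (k + 1)) (c : M) :
    𝓜.IsRel k (fun a => a i = c) := by
  have h := hc (.eq i (k + 1)) k (fun i => i) Fin.val_injective (fun _ => c)
    (fun _ _ => ∅) (by simp [SOFormula.freeRel])
  have hne (a : Fin (k + 1) → M) :
      Function.extend (fun i : Fin (k + 1) => (i : ℕ)) a (fun _ => c) (k + 1) = c :=
    Function.extend_apply' _ _ _ (by rintro ⟨j, hj⟩; exact j.isLt.ne hj)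
  simpa [IsRel, Sat, Fin.val_injective.extend_apply, hne] using h

theorem isRel_comp [Nonempty M] (hc : 𝓜.Comprehension) {k m : ℕ} {R : Set (Fin (k + 1) → M)}
    (hR : R ∈ 𝓜.S k) (σ : Fin (k + 1) → Fin (m + 1)) :
    𝓜.IsRel m (fun a => (fun j => a (σ j)) ∈ R) := by
  have h := hc (.rel k 0 fun j => σ j) m (fun i => i) Fin.val_injective
    (fun _ => Classical.arbitrary M) (Function.update (fun _ _ => ∅) k fun _ => R)
    (by
      rintro p rfl
      simpa using hR)
  simpa [IsRel, Sat, Fin.val_injective.extend_apply] using h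

theorem IsConcept.isRel [Nonempty M] {X : Set M} (hX : 𝓜.IsConcept X) (hc : 𝓜.Comprehension)
    {k : ℕ} (i : Fin (k + 1)) : 𝓜.IsRel k (fun a => a i ∈ X) :=
  isRel_comp hc hX fun _ => i

theorem HasFun.isRel [Nonempty M] {X : Set M} {f : M → M} (hf : 𝓜.HasFun X f)
    (hc : 𝓜.Comprehension) {k : ℕ} (i j : Fin (k + 1)) :
    𝓜.IsRel k (fun a => a i ∈ X ∧ f (a i) = a j) :=
  isRel_comp hc hf ![i, j]

theorem IsConcept.compl [Nonempty M] {X : Set M} (hX : 𝓜.IsConcept X) (hc : 𝓜.Comprehension) :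
    𝓜.IsConcept Xᶜ :=
  IsRel.not hc hX

theorem IsConcept.diff [Nonempty M] {X Y : Set M} (hX : 𝓜.IsConcept X) (hY : 𝓜.IsConcept Y)
    (hc : 𝓜.Comprehension) : 𝓜.IsConcept (X \ Y) :=
  IsRel.and hc hX (IsRel.not hc hY)

theorem isConcept_empty [Nonempty M] (hc : 𝓜.Comprehension) : 𝓜.IsConcept (∅ : Set M) :=
  isRel_false hc 0

theorem isConcept_singleton (hc : 𝓜.Comprehension) (c : M) : 𝓜.IsConcept {c} :=
  isRel_eq_const hc 0 c

theorem IsConcept.symmDiff [Nonempty M] {X Y : Set M} (hX : 𝓜.IsConcept X) (hY : 𝓜.IsConcept Y)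
    (hc : 𝓜.Comprehension) : 𝓜.IsConcept (symmDiff X Y) :=
  IsRel.or hc (hX.diff hY hc) (hY.diff hX hc)

/-! ### Permutations belonging to the structure -/

/-- The permutation `π` of the domain belongs to the structure. -/
def InternalPerm (𝓜 : HenkinStructure M) (π : Equiv.Perm M) : Prop :=
  𝓜.IsRel 1 (fun a => π (a 0) = a 1)

theorem InternalPerm.isRel [Nonempty M] {π : Equiv.Perm M} (hπ : 𝓜.InternalPerm π)
    (hc : 𝓜.Comprehension) {k : ℕ} (i j : Fin (k + 1)) :
    𝓜.IsRel k (fun a => π (a i) = a j) :=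
  isRel_comp hc hπ ![i, j]

theorem InternalPerm.inv [Nonempty M] {π : Equiv.Perm M} (hπ : 𝓜.InternalPerm π)
    (hc : 𝓜.Comprehension) : 𝓜.InternalPerm π⁻¹ :=
  (hπ.isRel hc 1 0).congr fun a => by rw [Equiv.Perm.inv_eq_iff_eq, eq_comm]

theorem InternalPerm.mul [Nonempty M] {π ρ : Equiv.Perm M} (hπ : 𝓜.InternalPerm π)
    (hρ : 𝓜.InternalPerm ρ) (hc : 𝓜.Comprehension) : 𝓜.InternalPerm (π * ρ) := by
  have h : 𝓜.IsRel 1 (fun a => ∃ y, ρ (a 0) = y ∧ π y = a 1) := by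
    apply IsRel.exists hc
    exact (hρ.isRel hc _ _).and hc (hπ.isRel hc _ _)
  exact h.congr fun a => by simp

theorem internalPerm_swap [Nonempty M] [DecidableEq M] (hc : 𝓜.Comprehension) (a b : M) :
    𝓜.InternalPerm (Equiv.swap a b) := by
  have h : 𝓜.IsRel 1 (fun x => x 0 = a ∧ x 1 = b ∨ x 0 = b ∧ x 1 = a ∨
      ¬ x 0 = a ∧ ¬ x 0 = b ∧ x 0 = x 1) :=
    ((isRel_eq_const hc 0 a).and hc (isRel_eq_const hc 1 b)).or hc <|
    ((isRel_eq_const hc 0 b).and hc (isRel_eq_const hc 1 a)).or hc <|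
    ((isRel_eq_const hc 0 a).not hc).and hc <|
    ((isRel_eq_const hc 0 b).not hc).and hc (isRel_eq hc 0 1)
  refine h.congr fun x => ?_
  rw [Equiv.swap_apply_def]
  grind

theorem internalPerm_one [Nonempty M] (hc : 𝓜.Comprehension) :
    𝓜.InternalPerm (1 : Equiv.Perm M) :=
  isRel_eq hc 0 1

/-- The relations of the structure are permuted by the permutations in it; the coordinates are
transformed one after another. -/
theorem InternalPerm.comp_mem [Nonempty M] {π : Equiv.Perm M} (hπ : 𝓜.InternalPerm π)
    (hc : 𝓜.Comprehension) {k : ℕ} {R : Set (Fin (k + 1) → M)} (hR : R ∈ 𝓜.S k) :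
    {a | (fun j => π (a j)) ∈ R} ∈ 𝓜.S k := by
  have key (s : Finset (Fin (k + 1))) :
      {a : Fin (k + 1) → M | (fun j => if j ∈ s then π (a j) else a j) ∈ R} ∈ 𝓜.S k := by
    induction s using Finset.induction_on with
    | empty =>
      simp only [Finset.notMem_empty, if_false]
      exact hR
    | insert i s hi ih =>
      have h : 𝓜.IsRel k (fun a => ∃ y, π (a i) = y ∧
          (fun j => if j ∈ s then π (if j = i then y else a j) else if j = i then y else a j)
            ∈ R) := by
        apply IsRel.exists hc
        refine (hπ.isRel hc i.succ 0).and hc ?_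
        refine (isRel_comp hc ih fun j => if j = i then 0 else j.succ).congr fun b => ?_
        simp only [Set.mem_ofPred_eq]
        congr! 3 with j <;> split_ifs <;> rfl
      refine h.congr fun a => ?_
      simp only [exists_eq_left']
      congr! 2 with j
      by_cases hj : j = i
      · subst hj; simp [hi]
      · simp [hj]
  simpa using key Finset.univ

theorem InternalPerm.image [Nonempty M] {π : Equiv.Perm M} (hπ : 𝓜.InternalPerm π)
    (hc : 𝓜.Comprehension) {X : Set M} (hX : 𝓜.IsConcept X) : 𝓜.IsConcept (π '' X) := by
  have h : 𝓜.IsRel 0 (fun a => ∃ y, y ∈ X ∧ π y = a 0) := by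
    apply IsRel.exists hc
    exact (hX.isRel hc _).and hc (hπ.isRel hc _ _)
  exact h

theorem InternalPerm.hasFun [Nonempty M] {π : Equiv.Perm M} (hπ : 𝓜.InternalPerm π)
    (hc : 𝓜.Comprehension) {X : Set M} (hX : 𝓜.IsConcept X) : 𝓜.HasFun X π :=
  (hX.isRel hc 0).and hc hπ

/-- The class `[X]_⊟` is the orbit of `X` under the permutations in the structure. -/
theorem mem_bicardClass_iff [Nonempty M] (hc : 𝓜.Comprehension) {X Y : Set M}
    (hX : 𝓜.IsConcept X) :
    Y ∈ 𝓜.bicardClass X ↔ ∃ π, 𝓜.InternalPerm π ∧ π '' X = Y := by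
  classical
  constructor
  · rintro ⟨-, ⟨f, hf, hfun⟩, g, hg, hgun⟩
    let h : M → M := fun x => if x ∈ X then f x else g x
    have hfX : Set.BijOn h X Y := hf.congr fun x hx => by simp [h, hx]
    have hgX : Set.BijOn h Xᶜ Yᶜ := hg.congr fun x hx => by
      have hx' : x ∉ X := hx
      simp [h, hx']
    have hmem (x : M) : h x ∈ Y ↔ x ∈ X :=
      ⟨fun hy => by_contra fun hx => hgX.mapsTo hx hy, fun hx => hfX.mapsTo hx⟩
    have hbij : Function.Bijective h := by
      constructor
      · intro x y hxy
        by_cases hx : x ∈ X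
        · exact hfX.injOn hx ((hmem y).1 (hxy ▸ (hmem x).2 hx)) hxy
        · exact hgX.injOn hx (fun hy => hx ((hmem x).1 (hxy ▸ (hmem y).2 hy))) hxy
      · intro y
        by_cases hy : y ∈ Y
        · exact (hfX.surjOn hy).imp fun _ => And.right
        · exact (hgX.surjOn hy).imp fun _ => And.right
    refine ⟨Equiv.ofBijective h hbij, ?_, hfX.image_eq⟩
    refine (IsRel.or hc hfun hgun).congr fun a => ?_
    by_cases ha : a 0 ∈ X <;> simp [h, ha]
  · rintro ⟨π, hπ, rfl⟩
    refine ⟨hπ.image hc hX, ⟨π, π.injective.injOn.bijOn_image, hπ.hasFun hc hX⟩,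
      π, ?_, hπ.hasFun hc (hX.compl hc)⟩
    rw [← Set.image_compl_eq π.bijective]
    exact π.injective.injOn.bijOn_image

theorem bicardClass_eq [Nonempty M] (hc : 𝓜.Comprehension) {X Y : Set M}
    (hX : 𝓜.IsConcept X) (hY : Y ∈ 𝓜.bicardClass X) : 𝓜.bicardClass Y = 𝓜.bicardClass X := by
  obtain ⟨π, hπ, rfl⟩ := (mem_bicardClass_iff hc hX).1 hY
  ext Z
  rw [mem_bicardClass_iff hc hX, mem_bicardClass_iff hc hY.1]
  constructor
  · rintro ⟨ρ, hρ, rfl⟩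
    exact ⟨ρ * π, hρ.mul hπ hc, by rw [Equiv.Perm.coe_mul, Set.image_comp]⟩
  · rintro ⟨ρ, hρ, rfl⟩
    exact ⟨ρ * π⁻¹, hρ.mul (hπ.inv hc) hc, by
      rw [← Set.image_comp, ← Equiv.Perm.coe_mul, inv_mul_cancel_right]⟩

theorem self_mem_bicardClass [Nonempty M] (hc : 𝓜.Comprehension) {X : Set M}
    (hX : 𝓜.IsConcept X) : X ∈ 𝓜.bicardClass X :=
  (mem_bicardClass_iff hc hX).2 ⟨1, internalPerm_one hc, by simp⟩

theorem InternalPerm.image_mem_bicardClass [Nonempty M] {π : Equiv.Perm M}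
    (hπ : 𝓜.InternalPerm π) (hc : 𝓜.Comprehension) {X Y : Set M} (hX : 𝓜.IsConcept X)
    (hY : Y ∈ 𝓜.bicardClass X) : π '' Y ∈ 𝓜.bicardClass X := by
  rw [← bicardClass_eq hc hX hY]
  exact (mem_bicardClass_iff hc hY.1).2 ⟨π, hπ, rfl⟩

/-! ### Invariance of definable relations -/

/-- Satisfaction depends only on the values of the free variables. -/
theorem sat_congr (φ : SOFormula) :
    ∀ {v v' : ℕ → M} {V V' : (k : ℕ) → ℕ → Set (Fin (k + 1) → M)},
      (∀ x ∈ φ.freeInd, v x = v' x) → (∀ p ∈ φ.freeRel, V p.1 p.2 = V' p.1 p.2) →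
      (𝓜.Sat φ v V ↔ 𝓜.Sat φ v' V') := by
  induction φ with
  | eq x y =>
    intro v v' V V' hv _
    simp only [Sat]
    rw [hv x (by simp [SOFormula.freeInd]), hv y (by simp [SOFormula.freeInd])]
  | rel k i x =>
    intro v v' V V' hv hV
    simp only [Sat]
    rw [hV (k, i) rfl, show (fun j => v (x j)) = fun j => v' (x j) from
      funext fun j => hv _ ⟨j, rfl⟩]
  | fls => intros; rfl
  | imp φ ψ ihφ ihψ =>
    intro v v' V V' hv hV
    exact imp_congr (ihφ (fun x hx => hv x (.inl hx)) fun p hp => hV p (.inl hp))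
      (ihψ (fun x hx => hv x (.inr hx)) fun p hp => hV p (.inr hp))
  | all x φ ih =>
    intro v v' V V' hv hV
    refine forall_congr' fun a => ih (fun y hy => ?_) hV
    by_cases h : y = x
    · subst h; simp
    · simpa [h] using hv y ⟨hy, h⟩
  | allRel k i φ ih =>
    intro v v' V V' hv hV
    refine forall₂_congr fun R _ => ih hv fun p hp => ?_
    obtain ⟨l, j⟩ := p
    by_cases h : l = k
    · subst h
      by_cases h' : j = i
      · subst h'; simp
      · simpa [h'] using hV (l, j) ⟨hp, by simpa using h'⟩
    · simpa [h] using hV (l, j) ⟨hp, by simp [h]⟩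

/-- Permutations in the structure are automorphisms of it. -/
theorem InternalPerm.sat_iff [Nonempty M] (hc : 𝓜.Comprehension) {π : Equiv.Perm M}
    (hπ : 𝓜.InternalPerm π) (φ : SOFormula) :
    ∀ (v : ℕ → M) (V : (k : ℕ) → ℕ → Set (Fin (k + 1) → M)),
      𝓜.Sat φ v V ↔
        𝓜.Sat φ (fun x => π (v x)) fun k i => {a | (fun j => π⁻¹ (a j)) ∈ V k i} := by
  induction φ with
  | eq x y => intro v V; simp [Sat]
  | rel k i x => intro v V; simp [Sat]
  | fls => intros; rfl
  | imp φ ψ ihφ ihψ => intro v V; exact imp_congr (ihφ v V) (ihψ v V)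
  | all x φ ih =>
    intro v V
    simp only [Sat]
    refine π.forall_congr fun a => ?_
    rw [ih]
    congr! 2 with y
    by_cases h : y = x
    · subst h; simp
    · simp [h]
  | allRel k i φ ih =>
    intro v V
    simp only [Sat]
    have hupd (R : Set (Fin (k + 1) → M)) :
        (fun l j => {a | (fun m => π⁻¹ (a m)) ∈
          Function.update V k (Function.update (V k) i R) l j}) =
        Function.update (fun l j => {a : Fin (l + 1) → M | (fun m => π⁻¹ (a m)) ∈ V l j}) k
          (Function.update (fun j => {a : Fin (k + 1) → M | (fun m => π⁻¹ (a m)) ∈ V k j}) i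
            {a | (fun m => π⁻¹ (a m)) ∈ R}) := by
      funext l j
      by_cases h : l = k
      · subst h
        by_cases h' : j = i
        · subst h'; simp
        · simp [h']
      · simp [h]
    constructor
    · intro h R hR
      have := (ih _ _).1 (h _ (hπ.comp_mem hc hR))
      rw [hupd] at this
      convert this
      ext a
      simp
    · intro h R hR
      rw [ih, hupd]
      exact h _ ((hπ.inv hc).comp_mem hc hR)

theorem L0Definable.image_iff [Nonempty M] (hc : 𝓜.Comprehension) {E : Set M → Set M → Prop}
    (hE : 𝓜.L0Definable E) {π : Equiv.Perm M} (hπ : 𝓜.InternalPerm π) {Y Z : Set M}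
    (hY : 𝓜.IsConcept Y) (hZ : 𝓜.IsConcept Z) : E (π '' Y) (π '' Z) ↔ E Y Z := by
  obtain ⟨φ, hφ, hφ', h⟩ := hE
  symm
  rw [h _ _ hY hZ, h _ _ (hπ.image hc hY) (hπ.image hc hZ), hπ.sat_iff hc φ]
  refine sat_congr φ (by simp [hφ]) fun p hp => ?_
  rcases hφ' hp with rfl | rfl
  · ext a; simp [conceptAssignment, Set.mem_image_equiv]
  · ext a; simp [conceptAssignment, Set.mem_image_equiv]

end HenkinStructure

/-! ### A formula for discernible pairs of sets -/

namespace SOFormula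

/-- Negation. -/
def neg (φ : SOFormula) : SOFormula := .imp φ .fls

/-- Conjunction. -/
def conj (φ ψ : SOFormula) : SOFormula := neg (.imp φ (neg ψ))

/-- Equivalence. -/
def iff (φ ψ : SOFormula) : SOFormula := conj (.imp φ ψ) (.imp ψ φ)

/-- Existential quantification over objects. -/
def ex (x : ℕ) (φ : SOFormula) : SOFormula := neg (.all x (neg φ))

/-- Existential quantification over relations of arity `k + 1`. -/
def exRel (k i : ℕ) (φ : SOFormula) : SOFormula := neg (.allRel k i (neg φ))

/-- The object `x` falls under the `i`-th concept variable. -/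
def mem (i x : ℕ) : SOFormula := .rel 0 i ![x]

/-- The objects `x`, `y` stand in the relation denoted by the binary relation variable with
index `0`. -/
def bin (x y : ℕ) : SOFormula := .rel 1 0 ![x, y]

/-- The formula `Φ(D)` that expresses `HenkinStructure.IsGap`, where `φ` defines `E`.  Since `φ`
speaks about the concept variables `0` and `1`, the value of the free variable `0` is first copied
to the variable `2`; then no variable of `φ` has to be renamed. -/
def gap (φ : SOFormula) : SOFormula :=
  exRel 0 2 <| conj (.all 0 <| iff (mem 2 0) (mem 0 0)) <| exRel 0 0 <| exRel 0 1 <|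
    conj (.all 0 <| iff (mem 2 0) <| conj (mem 0 0) <| neg <| mem 1 0) <|
    conj (exRel 1 0 <|
      conj (.all 0 <| .all 1 <| .all 2 <| .imp (bin 0 1) <| .imp (bin 0 2) <| .eq 1 2) <|
      conj (.all 0 <| .all 1 <| .all 2 <| .imp (bin 0 2) <| .imp (bin 1 2) <| .eq 0 1) <|
      conj (.all 0 <| .imp (mem 0 0) <| .imp (neg <| mem 1 0) <|
        ex 1 <| conj (mem 1 1) <| conj (neg <| mem 0 1) <| bin 0 1) <|
      .all 0 <| .imp (mem 1 0) <| .imp (neg <| mem 0 0) <|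
        ex 1 <| conj (mem 0 1) <| conj (neg <| mem 1 1) <| bin 1 0) <|
    conj (neg φ) <|
    .all 0 <| .imp (mem 0 0) <| .all 1 <| .imp (neg <| mem 0 1) <| .allRel 0 1 <|
      .imp (.all 2 <| iff (mem 1 2) <| .imp (neg <| .eq 2 1) <|
        conj (mem 0 2) <| neg <| .eq 2 0) φ

theorem freeInd_gap {φ : SOFormula} (hφ : φ.freeInd = ∅) : (gap φ).freeInd = ∅ := by
  have h1 (x : ℕ) : Set.range ![x] = {x} := by simp
  have h2 (x y : ℕ) : Set.range ![x, y] = {x, y} := by simp [Set.pair_comm]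
  ext x
  simp only [gap, neg, conj, iff, ex, exRel, mem, bin, freeInd, hφ, h1, h2]
  simp
  grind

theorem freeRel_gap {φ : SOFormula} (hφ : φ.freeRel ⊆ {(0, 0), (0, 1)}) :
    (gap φ).freeRel ⊆ {(0, 0)} := by
  intro p
  have := @hφ p
  simp only [gap, neg, conj, iff, ex, exRel, mem, bin, freeRel]
  simp at this ⊢
  grind

end SOFormula

namespace HenkinStructure

variable {M : Type*} {𝓜 : HenkinStructure M}

theorem sat_neg (φ : SOFormula) (v V) : 𝓜.Sat φ.neg v V ↔ ¬ 𝓜.Sat φ v V := Iff.rfl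

theorem sat_conj (φ ψ : SOFormula) (v V) :
    𝓜.Sat (φ.conj ψ) v V ↔ 𝓜.Sat φ v V ∧ 𝓜.Sat ψ v V := by
  simp only [SOFormula.conj, SOFormula.neg, Sat]
  tauto

theorem sat_iff (φ ψ : SOFormula) (v V) :
    𝓜.Sat (φ.iff ψ) v V ↔ (𝓜.Sat φ v V ↔ 𝓜.Sat ψ v V) := by
  simp only [SOFormula.iff, sat_conj, Sat]
  tauto

theorem sat_ex (x : ℕ) (φ : SOFormula) (v V) :
    𝓜.Sat (φ.ex x) v V ↔ ∃ a, 𝓜.Sat φ (Function.update v x a) V := by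
  simp only [SOFormula.ex, sat_neg, Sat]
  push Not
  rfl

theorem sat_exRel (k i : ℕ) (φ : SOFormula) (v V) :
    𝓜.Sat (φ.exRel k i) v V ↔
      ∃ R ∈ 𝓜.S k, 𝓜.Sat φ v (Function.update V k (Function.update (V k) i R)) := by
  simp only [SOFormula.exRel, sat_neg, Sat]
  push Not
  rfl

theorem forall_mem_S_zero {P : Set (Fin 1 → M) → Prop} :
    (∀ R ∈ 𝓜.S 0, P R) ↔ ∀ Y : Set M, 𝓜.IsConcept Y → P {a | a 0 ∈ Y} := by
  refine ⟨fun h Y hY => h _ hY, fun h R hR => ?_⟩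
  have hR' : {a : Fin 1 → M | a 0 ∈ {x | (fun _ => x) ∈ R}} = R := by
    ext a
    have : (fun _ => a 0) = a := funext fun i => by rw [Subsingleton.elim i 0]
    simp [this]
  have := h {x | (fun _ => x) ∈ R} (by rwa [IsConcept, hR'])
  rwa [hR'] at this

theorem exists_mem_S_zero {P : Set (Fin 1 → M) → Prop} :
    (∃ R ∈ 𝓜.S 0, P R) ↔ ∃ Y : Set M, 𝓜.IsConcept Y ∧ P {a | a 0 ∈ Y} := by
  have := forall_mem_S_zero (𝓜 := 𝓜) (P := fun R => ¬ P R)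
  rw [← not_iff_not]
  push Not
  exact this

theorem sat_mem (i x : ℕ) (v V) :
    𝓜.Sat (SOFormula.mem i x) v V ↔ (fun _ => v x) ∈ V 0 i := by
  simp only [SOFormula.mem, Sat]
  congr! 2 with j
  simp

theorem sat_bin (x y : ℕ) (v V) :
    𝓜.Sat (SOFormula.bin x y) v V ↔ ![v x, v y] ∈ V 1 0 := by
  simp only [SOFormula.bin, Sat]
  congr! 2 with j
  fin_cases j <;> rfl

/-- The binary relation `R` matches the elements of `A` with the elements of `B`. -/
def Matches (R : Set (Fin 2 → M)) (A B : Set M) : Prop :=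
  (∀ x y z, ![x, y] ∈ R → ![x, z] ∈ R → y = z) ∧
  (∀ x y z, ![x, z] ∈ R → ![y, z] ∈ R → x = y) ∧
  (∀ x ∈ A, ∃ y ∈ B, ![x, y] ∈ R) ∧
  ∀ y ∈ B, ∃ x ∈ A, ![x, y] ∈ R

open Classical in
/-- `E` does not distinguish `Y` from the sets that arise from it when an element is exchanged for
a non-element. -/
def SwapInvariant (E : Set M → Set M → Prop) (Y : Set M) : Prop :=
  ∀ a ∈ Y, ∀ b ∉ Y, E Y (Equiv.swap a b '' Y)

/-- `D` is the difference `Y \ Z` of concepts that are not equivalent under `E`, although `Y` is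
equivalent to the sets that arise from it by exchanging one element, and `Y \ Z` and `Z \ Y` are
equinumerous in the structure. -/
def IsGap (𝓜 : HenkinStructure M) (E : Set M → Set M → Prop) (D : Set M) : Prop :=
  ∃ Y, 𝓜.IsConcept Y ∧ ∃ Z, 𝓜.IsConcept Z ∧ D = Y \ Z ∧
    (∃ R ∈ 𝓜.S 1, Matches R (Y \ Z) (Z \ Y)) ∧ ¬ E Y Z ∧ SwapInvariant E Y

theorem mem_swap_image [DecidableEq M] {Y : Set M} {a b x : M} (ha : a ∈ Y) (hb : b ∉ Y) :
    x ∈ Equiv.swap a b '' Y ↔ (x ≠ b → x ∈ Y ∧ x ≠ a) := by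
  rw [Set.mem_image_equiv, Equiv.symm_swap, Equiv.swap_apply_def]
  grind

theorem sat_gap [Nonempty M] (hc : 𝓜.Comprehension) {E : Set M → Set M → Prop} {φ : SOFormula}
    (hφ : φ.freeInd = ∅) (hφ' : φ.freeRel ⊆ {(0, 0), (0, 1)})
    (hE : ∀ X Y, 𝓜.IsConcept X → 𝓜.IsConcept Y →
      (E X Y ↔ 𝓜.Sat φ (fun _ => Classical.arbitrary M) (conceptAssignment X Y)))
    {D : Set M} (hD : 𝓜.IsConcept D) :
    𝓜.Sat (SOFormula.gap φ) (fun _ => Classical.arbitrary M) (conceptAssignment D D) ↔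
      𝓜.IsGap E D := by
  classical
  have hE' {v V Y Z} (hY : 𝓜.IsConcept Y) (hZ : 𝓜.IsConcept Z) (h0 : V 0 0 = {a | a 0 ∈ Y})
      (h1 : V 0 1 = {a | a 0 ∈ Z}) : 𝓜.Sat φ v V ↔ E Y Z := by
    rw [hE Y Z hY hZ]
    refine sat_congr φ (by simp [hφ]) fun p hp => ?_
    rcases hφ' hp with rfl | rfl
    exacts [h0, h1]
  simp only [SOFormula.gap, sat_exRel, sat_conj, sat_iff, sat_ex, sat_neg, Sat, sat_mem, sat_bin,
    exists_mem_S_zero, forall_mem_S_zero]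
  simp [conceptAssignment]
  constructor
  · rintro ⟨C, -, hCD, Y, hY, Z, hZ, hC, ⟨R, hR, h1, h2, h3, h4⟩, hn, hs⟩
    refine ⟨Y, hY, Z, hZ, Set.ext fun x => (hCD x).symm.trans (hC x), ⟨R, hR, h1, h2, ?_, ?_⟩,
      fun h => hn ((hE' hY hZ (by simp) (by simp)).2 h), fun a ha b hb => ?_⟩
    · rintro x ⟨hx, hx'⟩
      obtain ⟨y, hy, hy', hxy⟩ := h3 x hx hx'
      exact ⟨y, ⟨hy, hy'⟩, hxy⟩
    · rintro y ⟨hy, hy'⟩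
      obtain ⟨x, hx, hx', hxy⟩ := h4 y hy hy'
      exact ⟨x, ⟨hx, hx'⟩, hxy⟩
    · have hW := (internalPerm_swap hc a b).image hc hY
      convert (hE' hY hW (by simp) (by simp)).1 (hs a ha b hb _ hW fun x => ?_)
      simpa using mem_swap_image ha hb
  · rintro ⟨Y, hY, Z, hZ, rfl, ⟨R, hR, h1, h2, h3, h4⟩, hn, hs⟩
    refine ⟨Y \ Z, hD, fun _ => Iff.rfl, Y, hY, Z, hZ, fun _ => Iff.rfl,
      ⟨R, hR, h1, h2, fun x hx hx' => ?_, fun y hy hy' => ?_⟩,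
      fun h => hn ((hE' hY hZ (by simp) (by simp)).1 h), fun a ha b hb W hW hW' => ?_⟩
    · obtain ⟨y, hy, hxy⟩ := h3 x ⟨hx, hx'⟩
      exact ⟨y, hy.1, hy.2, hxy⟩
    · obtain ⟨x, hx, hxy⟩ := h4 y ⟨hy, hy'⟩
      exact ⟨x, hx.1, hx.2, hxy⟩
    · have : W = Equiv.swap a b '' Y := Set.ext fun x => by
        rw [hW', mem_swap_image ha hb]
      refine (hE' hY hW (by simp) (by simp)).2 ?_
      rw [this]
      convert hs a ha b hb

/-! ### Sets that are finite in the structure -/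

theorem IsInfinite.of_cardLE [Nonempty M] (hc : 𝓜.Comprehension) {X Y : Set M}
    (hX : 𝓜.IsConcept X) (hY : 𝓜.IsInfinite Y) (h : 𝓜.CardLE Y X) : 𝓜.IsInfinite X := by
  classical
  obtain ⟨f, hf, hfinj, hfun⟩ := hY
  obtain ⟨i, hi, hinj, hiun⟩ := h
  have hfY : Set.MapsTo f Y Y := fun y hy => hf.1 ⟨y, hy, rfl⟩
  have hleft (y : M) (hy : y ∈ Y) : Function.invFunOn i Y (i y) = y :=
    hinj.leftInvOn_invFunOn hy
  -- `f` is transported along `i` and extended by the identity.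
  let g : M → M := fun x => if x ∈ i '' Y then i (f (Function.invFunOn i Y x)) else x
  have hg (y : M) (hy : y ∈ Y) : g (i y) = i (f y) := by
    simp only [g]
    rw [if_pos ⟨y, hy, rfl⟩, hleft y hy]
  have hg' (x : M) (hx : x ∉ i '' Y) : g x = x := if_neg hx
  have hiY (y : M) (hy : y ∈ Y) : i y ∈ i '' Y := ⟨y, hy, rfl⟩
  obtain ⟨y₀, hy₀, hy₀f⟩ := Set.exists_of_ssubset hf
  refine ⟨g, (Set.ssubset_iff_of_subset ?_).2 ⟨i y₀, hi hy₀, ?_⟩, ?_, ?_⟩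
  · rintro - ⟨x, hx, rfl⟩
    by_cases hxi : x ∈ i '' Y
    · obtain ⟨y, hy, rfl⟩ := hxi
      rw [hg y hy]
      exact hi (hfY hy)
    · rwa [hg' x hxi]
  · rintro ⟨x, hx, hxy⟩
    by_cases hxi : x ∈ i '' Y
    · obtain ⟨y, hy, rfl⟩ := hxi
      rw [hg y hy] at hxy
      exact hy₀f ⟨y, hy, hinj (hfY hy) hy₀ hxy⟩
    · rw [hg' x hxi] at hxy
      exact hxi (hxy ▸ hiY y₀ hy₀)
  · intro x hx x' hx' hxx'
    by_cases hxi : x ∈ i '' Y <;> by_cases hxi' : x' ∈ i '' Y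
    · obtain ⟨y, hy, rfl⟩ := hxi
      obtain ⟨y', hy', rfl⟩ := hxi'
      rw [hg y hy, hg y' hy'] at hxx'
      rw [hfinj hy hy' (hinj (hfY hy) (hfY hy') hxx')]
    · obtain ⟨y, hy, rfl⟩ := hxi
      rw [hg y hy, hg' x' hxi'] at hxx'
      exact absurd (hxx' ▸ hiY _ (hfY hy)) hxi'
    · obtain ⟨y', hy', rfl⟩ := hxi'
      rw [hg' x hxi, hg y' hy'] at hxx'
      exact absurd (hxx' ▸ hiY _ (hfY hy')) hxi
    · rwa [hg' x hxi, hg' x' hxi'] at hxx'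
  · have h : 𝓜.IsRel 1 (fun a => a 0 ∈ X ∧
        ((∃ y, (y ∈ Y ∧ i y = a 0) ∧ ∃ z, (y ∈ Y ∧ f y = z) ∧ z ∈ Y ∧ i z = a 1) ∨
          (¬ ∃ y, y ∈ Y ∧ i y = a 0) ∧ a 0 = a 1)) := by
      refine (hX.isRel hc _).and hc (IsRel.or hc ?_ (IsRel.and hc (IsRel.not hc ?_) ?_))
      · apply IsRel.exists hc
        refine (hiun.isRel hc _ _).and hc ?_
        apply IsRel.exists hc
        exact (hfun.isRel hc _ _).and hc (hiun.isRel hc _ _)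
      · apply IsRel.exists hc
        exact hiun.isRel hc _ _
      · exact isRel_eq hc _ _
    refine h.congr fun a => and_congr_right fun _ => ?_
    by_cases hxi : a 0 ∈ i '' Y
    · obtain ⟨y, hy, hya⟩ := hxi
      rw [← hya, hg y hy]
      constructor
      · rintro (⟨y', ⟨hy', hyy⟩, z, ⟨-, rfl⟩, -, hz⟩ | ⟨hn, -⟩)
        · rw [← hz, hinj hy' hy hyy]
        · exact absurd ⟨y, hy, rfl⟩ hn
      · intro hz
        exact .inl ⟨y, ⟨hy, rfl⟩, f y, ⟨hy, rfl⟩, hfY hy, hz⟩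
    · rw [hg' _ hxi]
      constructor
      · rintro (⟨y', hy', -⟩ | h)
        · exact absurd ⟨y', hy'⟩ hxi
        · exact h.2
      · exact fun h => .inr ⟨hxi, h⟩

theorem CardLE.of_subset [Nonempty M] (hc : 𝓜.Comprehension) {X Y : Set M}
    (hX : 𝓜.IsConcept X) (h : X ⊆ Y) : 𝓜.CardLE X Y :=
  ⟨id, h, Set.injOn_id X, (hX.isRel hc 0).and hc (isRel_eq hc 0 1)⟩

theorem not_isInfinite_of_mem_bicardClass [Nonempty M] (hc : 𝓜.Comprehension) {X Y : Set M}
    (hX : 𝓜.IsConcept X) (hfin : ¬ 𝓜.IsInfinite X) (hY : Y ∈ 𝓜.bicardClass X) :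
    ¬ 𝓜.IsInfinite Y := by
  obtain ⟨π, hπ, rfl⟩ := (mem_bicardClass_iff hc hX).1 hY
  refine fun h => hfin (h.of_cardLE hc hX ⟨⇑π⁻¹, ?_, (π⁻¹).injective.injOn,
    (hπ.inv hc).hasFun hc hY.1⟩)
  rintro - ⟨x, hx, rfl⟩
  simpa using hx

/-- An injection of `Y \ Z` into `Z \ Y` is onto if `Z` is a copy of `Y` and `Y` is finite in the
structure: with the identity on `Y ∩ Z` it gives an injection of `Y` into `Z`. -/
theorem exists_matches_of_cardLE [Nonempty M] (hc : 𝓜.Comprehension) {Y : Set M}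
    (hY : 𝓜.IsConcept Y) (hfin : ¬ 𝓜.IsInfinite Y) {π : Equiv.Perm M} (hπ : 𝓜.InternalPerm π)
    (h : 𝓜.CardLE (Y \ π '' Y) (π '' Y \ Y)) :
    ∃ R ∈ 𝓜.S 1, Matches R (Y \ π '' Y) (π '' Y \ Y) := by
  classical
  obtain ⟨f, hf, hinj, hfun⟩ := h
  set Z := π '' Y
  have hZc : 𝓜.IsConcept Z := hπ.image hc hY
  let g : M → M := fun x => if x ∈ Z then x else f x
  have hgZ : Set.MapsTo g Y Z := fun x hx => by
    by_cases hxZ : x ∈ Z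
    · simp [g, hxZ]
    · simpa [g, hxZ] using (hf ⟨hx, hxZ⟩).1
  have hginj : Set.InjOn g Y := by
    intro x hx y hy hxy
    by_cases hxZ : x ∈ Z <;> by_cases hyZ : y ∈ Z <;>
      simp only [g, hxZ, hyZ, if_true, if_false] at hxy
    · exact hxy
    · exact absurd (hxy ▸ hx) (hf ⟨hy, hyZ⟩).2
    · exact absurd (hxy ▸ hy) (hf ⟨hx, hxZ⟩).2
    · exact hinj ⟨hx, hxZ⟩ ⟨hy, hyZ⟩ hxy
  have hmaps : Set.MapsTo (⇑π⁻¹ ∘ g) Y Y := fun x hx => by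
    obtain ⟨y, hy, hyx⟩ := hgZ hx
    simpa [← hyx] using hy
  have hhun : 𝓜.HasFun Y (⇑π⁻¹ ∘ g) := by
    have h : 𝓜.IsRel 1 (fun a => a 0 ∈ Y ∧ (a 0 ∈ Z ∧ π (a 1) = a 0 ∨
        ∃ y, (a 0 ∈ Y \ Z ∧ f (a 0) = y) ∧ π (a 1) = y)) := by
      refine (hY.isRel hc _).and hc (((hZc.isRel hc _).and hc (hπ.isRel hc _ _)).or hc ?_)
      apply IsRel.exists hc
      exact (hfun.isRel hc _ _).and hc (hπ.isRel hc _ _)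
    refine h.congr fun a => and_congr_right fun ha => ?_
    rw [Function.comp_apply, Equiv.Perm.inv_eq_iff_eq]
    by_cases haZ : a 0 ∈ Z
    · simp [g, haZ, eq_comm]
    · simp [g, haZ, ha, eq_comm]
  have hsurj : Y ⊆ (⇑π⁻¹ ∘ g) '' Y := by
    by_contra hn
    exact hfin ⟨⇑π⁻¹ ∘ g, ⟨hmaps.image_subset, hn⟩, (π⁻¹).injective.comp_injOn hginj, hhun⟩
  refine ⟨_, hfun, ?_, ?_, ?_, ?_⟩
  · rintro x y z ⟨-, hy⟩ ⟨-, hz⟩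
    exact hy.symm.trans hz
  · rintro x y z ⟨hx, hxz⟩ ⟨hy, hyz⟩
    exact hinj hx hy (hxz.trans hyz.symm)
  · exact fun x hx => ⟨f x, hf hx, hx, rfl⟩
  · rintro z ⟨hz, hzY⟩
    obtain ⟨y, hy, rfl⟩ := hz
    obtain ⟨x, hx, hxy⟩ := hsurj hy
    have hgx : g x = π y := by
      rw [← hxy]; simp
    by_cases hxZ : x ∈ Z
    · simp only [g, hxZ, if_true] at hgx
      exact absurd (hgx ▸ hx) hzY
    · simp only [g, hxZ, if_false] at hgx
      exact ⟨x, ⟨hx, hxZ⟩, ⟨hx, hxZ⟩, hgx⟩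

theorem exists_matches [Nonempty M] (hc : 𝓜.Comprehension) (hcomp : 𝓜.CardinalComparability)
    {X Y Z : Set M} (hX : 𝓜.IsConcept X) (hfin : ¬ 𝓜.IsInfinite X)
    (hY : Y ∈ 𝓜.bicardClass X) (hZ : Z ∈ 𝓜.bicardClass X) :
    ∃ R ∈ 𝓜.S 1, Matches R (Y \ Z) (Z \ Y) := by
  have key {Y Z : Set M} (hY : Y ∈ 𝓜.bicardClass X) (hZ : Z ∈ 𝓜.bicardClass X)
      (h : 𝓜.CardLE (Y \ Z) (Z \ Y)) : ∃ R ∈ 𝓜.S 1, Matches R (Y \ Z) (Z \ Y) := by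
    rw [← bicardClass_eq hc hX hY] at hZ
    obtain ⟨π, hπ, rfl⟩ := (mem_bicardClass_iff hc hY.1).1 hZ
    exact exists_matches_of_cardLE hc hY.1
      (not_isInfinite_of_mem_bicardClass hc hX hfin hY) hπ h
  rcases hcomp _ _ (hY.1.diff hZ.1 hc) (hZ.1.diff hY.1 hc) with h | h
  · exact key hY hZ h
  · obtain ⟨R, hR, h1, h2, h3, h4⟩ := key hZ hY h
    have hR' : {a : Fin 2 → M | ![a 1, a 0] ∈ R} ∈ 𝓜.S 1 := by
      refine (isRel_comp hc hR ![1, 0]).congr fun a => ?_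
      congr! 2 with j
      fin_cases j <;> rfl
    exact ⟨_, hR', fun x y z hy hz => h2 _ _ _ hy hz, fun x y z hx hy => h1 _ _ _ hx hy, h4, h3⟩

/-! ### The dichotomy -/

section

variable [Nonempty M] {E : Set M → Set M → Prop}

/-- If `E` identifies two sets that differ in an exchange of one element, then it identifies all
such pairs in their class, because the permutations in the structure act transitively on them. -/
theorem swapInvariant_of_swap [DecidableEq M] (hc : 𝓜.Comprehension) (hE : 𝓜.L0Definable E)
    {X Y Z : Set M} (hX : 𝓜.IsConcept X) (hY : Y ∈ 𝓜.bicardClass X) (hZ : Z ∈ 𝓜.bicardClass X)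
    {a b : M} (ha : a ∈ Y) (hb : b ∉ Y) (h : E Y (Equiv.swap a b '' Y)) : SwapInvariant E Z := by
  intro c hcZ d hd
  rw [← bicardClass_eq hc hX hY] at hZ
  obtain ⟨π, hπ, rfl⟩ := (mem_bicardClass_iff hc hY.1).1 hZ
  -- `ρ` corrects `π` so that `a`, `b` are sent to `c`, `d`.
  let ρ : Equiv.Perm M := Equiv.swap (π a) c * Equiv.swap (π b) d * π
  have hρ : 𝓜.InternalPerm ρ :=
    ((internalPerm_swap hc _ _).mul (internalPerm_swap hc _ _) hc).mul hπ hc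
  have hπa : π a ∈ π '' Y := ⟨a, ha, rfl⟩
  have hπb : π b ∉ π '' Y := by simpa using hb
  have h1 : Equiv.swap (π a) c '' (π '' Y) = π '' Y := by
    ext x
    rw [Set.mem_image_equiv, Equiv.symm_swap, Equiv.swap_apply_def]
    split_ifs with h h' <;> simp_all
  have h2 : Equiv.swap (π b) d '' (π '' Y) = π '' Y := by
    ext x
    rw [Set.mem_image_equiv, Equiv.symm_swap, Equiv.swap_apply_def]
    split_ifs with h h' <;> simp_all
  have hρY : ρ '' Y = π '' Y := by
    simp only [ρ, Equiv.Perm.coe_mul, Set.image_comp, h1, h2]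
  have hρa : ρ a = c := by
    have hne : π a ≠ π b := fun h => hπb (h ▸ hπa)
    have hne' : π a ≠ d := fun h => hd (h ▸ hπa)
    simp [ρ, Equiv.swap_apply_of_ne_of_ne hne hne']
  have hρb : ρ b = d := by
    have hne : d ≠ π a := fun h => hd (h ▸ hπa)
    have hne' : d ≠ c := fun h => hd (h ▸ hcZ)
    simp [ρ, Equiv.swap_apply_of_ne_of_ne hne hne']
  have hswap : Equiv.swap c d '' (π '' Y) = ρ '' (Equiv.swap a b '' Y) := by
    rw [← hρY, ← Set.image_comp, ← Set.image_comp, ← Equiv.Perm.coe_mul, ← Equiv.Perm.coe_mul,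
      ← hρa, ← hρb, Equiv.mul_swap_eq_swap_mul]
  have := (hE.image_iff hc hρ hY.1 ((internalPerm_swap hc a b).image hc hY.1)).2 h
  rw [← hswap, hρY] at this
  convert this

/-- A set that is related to `Y`, but is neither `Y` nor its complement, is moved by some
transposition that fixes `Y`; so it is related to its image. -/
theorem exists_swap_of_ne [DecidableEq M] (hc : 𝓜.Comprehension) (hE : 𝓜.L0Definable E)
    (hE' : 𝓜.IsEquivOnConcepts E) {X Y Z : Set M} (hX : 𝓜.IsConcept X)
    (hY : Y ∈ 𝓜.bicardClass X) (hZ : Z ∈ 𝓜.bicardClass X) (h : E Y Z) (hne : Z ≠ Y)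
    (hne' : Z ≠ Yᶜ) : ∃ a ∈ Z, ∃ b ∉ Z, E Z (Equiv.swap a b '' Z) := by
  have key {a b : M} (ha : a ∈ Z) (hb : b ∉ Z) (hab : a ∈ Y ↔ b ∈ Y) :
      ∃ a ∈ Z, ∃ b ∉ Z, E Z (Equiv.swap a b '' Z) := by
    have hs := internalPerm_swap hc a b
    have hYs : Equiv.swap a b '' Y = Y := by
      ext x
      rw [Set.mem_image_equiv, Equiv.symm_swap, Equiv.swap_apply_def]
      split_ifs with h h' <;> simp_all
    have := (hE.image_iff hc hs hY.1 hZ.1).2 h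
    rw [hYs] at this
    exact ⟨a, ha, b, hb, hE'.trans _ _ _ hZ.1 hY.1 (hs.image hc hZ.1)
      (hE'.symm _ _ hY.1 hZ.1 h) this⟩
  by_contra hcon
  -- Otherwise `Z` and its complement are separated by `Y`.
  have hsep (a b : M) (ha : a ∈ Z) (hb : b ∉ Z) : ¬ (a ∈ Y ↔ b ∈ Y) := fun h => hcon (key ha hb h)
  rw [← bicardClass_eq hc hX hY] at hZ
  obtain ⟨π, hπ, rfl⟩ := (mem_bicardClass_iff hc hY.1).1 hZ
  rcases Set.eq_empty_or_nonempty (π '' Y) with h0 | ⟨a, ha⟩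
  · rw [Set.image_eq_empty] at h0
    subst h0
    simp at hne
  · by_cases h1 : ∃ b, b ∉ π '' Y
    · obtain ⟨b, hb⟩ := h1
      by_cases haY : a ∈ Y
      · refine hne (Set.ext fun x => ?_)
        have hbY : b ∉ Y := fun h => hsep a b ha hb (iff_of_true haY h)
        by_cases hx : x ∈ π '' Y
        · have := hsep x b hx hb
          tauto
        · have := hsep a x ha hx
          tauto
      · refine hne' (Set.ext fun x => ?_)
        have hbY : b ∈ Y := by_contra fun h => hsep a b ha hb (iff_of_false haY h)
        rw [Set.mem_compl_iff]
        by_cases hx : x ∈ π '' Y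
        · have := hsep x b hx hb
          tauto
        · have := hsep a x ha hx
          tauto
    · push Not at h1
      have hYu : Y = Set.univ := Set.eq_univ_of_forall fun x => by simpa using h1 (π x)
      subst hYu
      simp at hne

/-- Cardinal well-foundedness gives the induction on the number of exchanges that lead from one
set to another: a gap `Y \ Z` of least cardinality could be narrowed by an exchange. -/
theorem equiv_of_swapInvariant (h𝓜 : 𝓜.WellBehaved) (hE : 𝓜.L0Definable E)
    (hE' : 𝓜.IsEquivOnConcepts E) {X Y Z : Set M} (hX : 𝓜.IsConcept X)
    (hfin : ¬ 𝓜.IsInfinite X) (hswap : SwapInvariant E Y)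
    (hY : Y ∈ 𝓜.bicardClass X) (hZ : Z ∈ 𝓜.bicardClass X) : E Y Z := by
  classical
  have hc := h𝓜.comprehension
  have hE₀ := hE
  obtain ⟨φ, hφ, hφ', hEφ⟩ := hE₀
  by_contra hn
  have hYZ := hY.1.diff hZ.1 hc
  have hgap : 𝓜.IsGap E (Y \ Z) := ⟨Y, hY.1, Z, hZ.1, rfl,
    exists_matches hc h𝓜.comparability hX hfin hY hZ, hn, hswap⟩
  obtain ⟨D, hD, hDgap, hmin⟩ := h𝓜.wellFounded (SOFormula.gap φ) (SOFormula.freeInd_gap hφ)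
    (SOFormula.freeRel_gap hφ') ⟨_, hYZ, (sat_gap hc hφ hφ' hEφ hYZ).2 hgap⟩
  replace hmin (D' : Set M) (hD' : 𝓜.IsConcept D') (h : 𝓜.IsGap E D') : 𝓜.CardLE D D' :=
    hmin D' hD' ((sat_gap hc hφ hφ' hEφ hD').2 h)
  rw [sat_gap hc hφ hφ' hEφ hD] at hDgap
  have hDfin : ¬ 𝓜.IsInfinite D := fun h =>
    not_isInfinite_of_mem_bicardClass hc hX hfin hY <|
      (h.of_cardLE hc hYZ (hmin _ hYZ hgap)).of_cardLE hc hY.1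
        (CardLE.of_subset hc hYZ Set.sdiff_subset)
  obtain ⟨Y, hY, Z, hZ, rfl, ⟨R, hR, h1, h2, h3, h4⟩, hn, hswap⟩ := hDgap
  obtain ⟨a, ha⟩ : (Y \ Z).Nonempty := by
    by_contra hemp
    have hsub : Y ⊆ Z := Set.sdiff_eq_empty.1 (Set.not_nonempty_iff_eq_empty.1 hemp)
    have hsub' : Z ⊆ Y := fun y hy => by
      by_contra hyY
      obtain ⟨x, hx, -⟩ := h4 y ⟨hy, hyY⟩
      exact hemp ⟨x, hx⟩
    rw [hsub.antisymm hsub'] at hn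
    exact hn (hE'.refl Z hZ)
  obtain ⟨b, hb, hab⟩ := h3 a ha
  have hs := internalPerm_swap hc a b
  have hYs := hs.image hc hY
  have hE1 : E Y (Equiv.swap a b '' Y) := by convert hswap a ha.1 b hb.2
  have hmem (x : M) := mem_swap_image (x := x) ha.1 hb.2
  have hd1 : Equiv.swap a b '' Y \ Z = (Y \ Z) \ {a} := by
    ext x
    have := hb.1
    simp only [Set.mem_sdiff, hmem, Set.mem_singleton_iff]
    grind
  have hd2 : Z \ Equiv.swap a b '' Y = (Z \ Y) \ {b} := by
    ext x
    have := ha.2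
    simp only [Set.mem_sdiff, hmem, Set.mem_singleton_iff]
    grind
  have hgap' : 𝓜.IsGap E ((Y \ Z) \ {a}) := by
    refine ⟨_, hYs, Z, hZ, hd1.symm, ⟨R, hR, h1, h2, ?_, ?_⟩,
      fun h => hn (hE'.trans _ _ _ hY hYs hZ hE1 h), ?_⟩
    · rw [hd1, hd2]
      rintro x ⟨hx, hxa⟩
      obtain ⟨y, hy, hxy⟩ := h3 x hx
      refine ⟨y, ⟨hy, ?_⟩, hxy⟩
      rintro rfl
      exact hxa (h2 _ _ _ hxy hab)
    · rw [hd1, hd2]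
      rintro y ⟨hy, hyb⟩
      obtain ⟨x, hx, hxy⟩ := h4 y hy
      refine ⟨x, ⟨hx, ?_⟩, hxy⟩
      rintro rfl
      exact hyb (h1 _ _ _ hxy hab)
    · exact swapInvariant_of_swap hc hE hY (self_mem_bicardClass hc hY)
        (hs.image_mem_bicardClass hc hY (self_mem_bicardClass hc hY)) ha.1 hb.2 hE1
  obtain ⟨f, hf, hfinj, hfun⟩ := hmin _ (hD.diff (isConcept_singleton hc a) hc) hgap'
  refine hDfin ⟨f, (Set.ssubset_iff_of_subset ?_).2 ⟨a, ha, ?_⟩, hfinj, hfun⟩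
  · exact hf.image_subset.trans Set.sdiff_subset
  · rintro ⟨x, hx, hxa⟩
    exact (hf hx).2 hxa

/-- The pairs of sets that are related by a nontrivial `E` on the class of a finite `X` consist of
equal or of complementary sets. -/
theorem eq_or_eq_compl_of_equiv (h𝓜 : 𝓜.WellBehaved) (hE : 𝓜.L0Definable E)
    (hE' : 𝓜.IsEquivOnConcepts E) {X Y Z : Set M} (hX : 𝓜.IsConcept X)
    (hfin : ¬ 𝓜.IsInfinite X) (hnontriv : ¬ 𝓜.IsTrivialAt E X)
    (hY : Y ∈ 𝓜.bicardClass X) (hZ : Z ∈ 𝓜.bicardClass X) (h : E Y Z) : Z = Y ∨ Z = Yᶜ := by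
  classical
  have hc := h𝓜.comprehension
  by_contra! hne
  obtain ⟨a, ha, b, hb, hab⟩ := exists_swap_of_ne hc hE hE' hX hY hZ h hne.1 hne.2
  have hXX := self_mem_bicardClass hc hX
  refine hnontriv (Set.ext fun W => ⟨And.left, fun hW => ⟨hW, ?_⟩⟩)
  exact equiv_of_swapInvariant h𝓜 hE hE' hX hfin
    (swapInvariant_of_swap hc hE hX hZ hXX ha hb hab) hXX hW

/-- If `E` relates one pair of complementary sets in the class, then it relates all of them. -/
theorem equiv_compl (hc : 𝓜.Comprehension) (hE : 𝓜.L0Definable E) {X Y Z : Set M}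
    (hX : 𝓜.IsConcept X) (hY : Y ∈ 𝓜.bicardClass X) (hYc : Yᶜ ∈ 𝓜.bicardClass X)
    (h : E Y Yᶜ) (hZ : Z ∈ 𝓜.bicardClass X) : Zᶜ ∈ 𝓜.bicardClass X ∧ E Z Zᶜ := by
  rw [← bicardClass_eq hc hX hY] at hZ
  obtain ⟨π, hπ, rfl⟩ := (mem_bicardClass_iff hc hY.1).1 hZ
  rw [← Set.image_compl_eq π.bijective]
  exact ⟨hπ.image_mem_bicardClass hc hX hYc, (hE.image_iff hc hπ hY.1 hYc.1).2 h⟩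

end

/-! ### Comparison with finite multiples -/

theorem not_triLE_empty {X : Set M} (hX : X.Nonempty) : ¬ 𝓜.TriLE X ∅ := by
  rintro ⟨Z, -, -, f, hf, -⟩
  obtain ⟨x, hx⟩ := hX
  exact (hf hx).2

theorem triLE_empty [Nonempty M] (hc : 𝓜.Comprehension) (X : Set M) : 𝓜.TriLE ∅ X := by
  have c := Classical.arbitrary M
  exact ⟨∅, isConcept_empty hc, Set.finite_empty, fun _ => (c, c), Set.mapsTo_empty _ _,
    Set.injOn_empty _, by simpa [HasPairFun, IsRel] using isRel_false hc 2⟩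

theorem triLT_empty [Nonempty M] (hc : 𝓜.Comprehension) {X : Set M} (hX : X.Nonempty) : 𝓜.TriLT ∅ X :=
  ⟨triLE_empty hc X, not_triLE_empty hX⟩

theorem negligible_empty_iff [Nonempty M] (hc : 𝓜.Comprehension) {A : Set M} :
    𝓜.Negligible A ∅ ↔ A = ∅ :=
  ⟨fun h => h.resolve_right fun h' => h'.2 (triLE_empty hc A), .inl⟩

theorem triLE_univ [Nonempty M] (hc : 𝓜.Comprehension) {X : Set M} (hX : 𝓜.IsConcept X) :
    𝓜.TriLE X Set.univ := by
  have c := Classical.arbitrary M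
  refine ⟨{c}, isConcept_singleton hc c, Set.finite_singleton c, fun x => (c, x),
    fun x _ => ⟨rfl, trivial⟩, fun x _ y _ h => (Prod.ext_iff.1 h).2, ?_⟩
  refine ((hX.isRel hc 0).and hc ((isRel_eq_const hc 1 c).and hc (isRel_eq hc 0 2))).congr ?_
  intro a
  simp [eq_comm]

theorem triLT_of_finite_of_infinite [Nonempty M] (hc : 𝓜.Comprehension) {A J : Set M} (hA : 𝓜.IsConcept A)
    (hAfin : A.Finite) (hJ : J.Infinite) : 𝓜.TriLT A J := by
  obtain ⟨j, hj⟩ := hJ.nonempty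
  constructor
  · refine ⟨A, hA, hAfin, fun x => (x, j), fun x hx => ⟨hx, hj⟩,
      fun x _ y _ h => (Prod.ext_iff.1 h).1, ?_⟩
    refine ((hA.isRel hc 0).and hc ((isRel_eq hc 0 1).and hc (isRel_eq_const hc 2 j))).congr ?_
    intro a
    simp [eq_comm]
  · rintro ⟨Z, -, hZ, f, hf, hinj, -⟩
    exact hJ (Set.Finite.of_injOn hf hinj (hZ.prod hAfin))

end HenkinStructure

/-! ### Measures of `E` on the class of a finite concept -/

open HenkinStructure in
theorem mainTheorem6 {M : Type*} [Nonempty M] (𝓜 : HenkinStructure M) (h𝓜 : 𝓜.WellBehaved)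
    (E : Set M → Set M → Prop) (hE : 𝓜.L0Definable E) (hE' : 𝓜.IsEquivOnConcepts E)
    (X : Set M) (hX : 𝓜.IsConcept X) (hfin : ¬ 𝓜.IsInfinite X)
    (hnontriv : ¬ 𝓜.IsTrivialAt E X) :
    (𝓜.IsProperlySeparativeAt E X ∨ 𝓜.IsProperlyComplementativeAt E X) ∧
    𝓜.IsMeasureAt E X ∅ ∧
    (∀ J, 𝓜.IsMeasureAt E X J → J.Finite) ∧
    (𝓜.IsProperlySeparativeAt E X →
      ∀ Y ∈ 𝓜.bicardClass X, 𝓜.sliceClass E Y = {Y}) ∧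
    (𝓜.IsProperlyComplementativeAt E X →
      ∀ Y ∈ 𝓜.bicardClass X, 𝓜.sliceClass E Y = {Y, Yᶜ}) := by
  classical
  have hc := h𝓜.comprehension
  have hXX := self_mem_bicardClass hc hX
  have hself : X ∈ 𝓜.sliceClass E X := ⟨hXX, hE'.refl X hX⟩
  have hpair {Y Z} (hY : Y ∈ 𝓜.bicardClass X) (hZ : Z ∈ 𝓜.bicardClass X) (h : E Y Z) :=
    eq_or_eq_compl_of_equiv h𝓜 hE hE' hX hfin hnontriv hY hZ h
  have hrefl {Y} (hY : Y ∈ 𝓜.bicardClass X) : E Y Y := hE'.refl Y hY.1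
  -- The class of `∅` and that of the whole domain are singletons, where `E` is trivial.
  obtain ⟨a, ha⟩ : X.Nonempty := by
    by_contra h
    rw [Set.not_nonempty_iff_eq_empty] at h
    refine hnontriv (Set.ext fun W => ⟨And.left, fun hW => ?_⟩)
    obtain ⟨π, -, rfl⟩ := (mem_bicardClass_iff hc hX).1 hW
    rw [show π '' X = X by simp [h]]
    exact hself
  obtain ⟨b, hb⟩ : ∃ b, b ∉ X := by
    by_contra! h
    replace h := Set.eq_univ_of_forall h
    refine hnontriv (Set.ext fun W => ⟨And.left, fun hW => ?_⟩)
    obtain ⟨π, -, rfl⟩ := (mem_bicardClass_iff hc hX).1 hW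
    rw [show π '' X = X by simp [h]]
    exact hself
  have hempty : 𝓜.TriLT ∅ X := triLT_empty hc ⟨a, ha⟩
  have huniv : ¬ 𝓜.TriLT Set.univ X := fun h => h.2 (triLE_univ hc hX)
  have hcompl (Y : Set M) : symmDiff Y Yᶜ = Set.univ := symmDiff_compl_self Y
  have hemp_iff (Y Z : Set M) : symmDiff Y Z = ∅ ↔ Z = Y := by
    rw [← Set.bot_eq_empty, symmDiff_eq_bot, eq_comm]
  have huniv_iff (Y Z : Set M) : (symmDiff Y Z)ᶜ = ∅ ↔ Z = Yᶜ := by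
    rw [Set.compl_empty_iff, ← Set.top_eq_univ, symmDiff_eq_top, isCompl_comm,
      ← eq_compl_iff_isCompl]
  -- A separative `E` is equality on the class of `X`.
  have hsep {Y Z} (hs : 𝓜.IsSeparativeAt E X) (hY : Y ∈ 𝓜.bicardClass X)
      (hZ : Z ∈ 𝓜.bicardClass X) (h : E Y Z) : Z = Y := by
    refine (hpair hY hZ h).resolve_right ?_
    rintro rfl
    have := hs _ hY _ hZ h
    rw [hcompl] at this
    exact huniv this
  -- Otherwise `E` relates each set to its complement.
  have hnsep (hs : ¬ 𝓜.IsSeparativeAt E X) {Y} (hY : Y ∈ 𝓜.bicardClass X) :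
      Yᶜ ∈ 𝓜.bicardClass X ∧ E Y Yᶜ := by
    simp only [IsSeparativeAt, not_forall] at hs
    obtain ⟨U, hU, W, hW, hUW, hlt⟩ := hs
    have hWU : W = Uᶜ := (hpair hU hW hUW).resolve_left fun h => hlt <| by
      rwa [(hemp_iff U W).2 h]
    subst hWU
    exact equiv_compl hc hE hX hU hW hUW hY
  have hcomp : 𝓜.IsComplementativeAt E X := by
    intro Y hY Z hZ h
    rcases hpair hY hZ h with h | h
    · exact .inl (by rwa [(hemp_iff Y Z).2 h])
    · exact .inr (by rwa [(huniv_iff Y Z).2 h])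
  refine ⟨?_, ⟨isConcept_empty hc, ?_⟩, ?_, ?_, ?_⟩
  · by_cases hs : 𝓜.IsSeparativeAt E X
    · exact .inl ⟨hs, hnontriv⟩
    · exact .inr ⟨hcomp, hs, hnontriv⟩
  · by_cases hs : 𝓜.IsSeparativeAt E X
    · refine .inl ⟨⟨hs, hnontriv⟩, fun Y hY Z hZ => ?_⟩
      rw [negligible_empty_iff hc, hemp_iff]
      refine ⟨hsep hs hY hZ, ?_⟩
      rintro rfl
      exact hrefl hZ
    · refine .inr ⟨⟨hcomp, hs, hnontriv⟩, fun Y hY Z hZ => ?_⟩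
      rw [negligible_empty_iff hc, negligible_empty_iff hc, hemp_iff, huniv_iff]
      refine ⟨hpair hY hZ, ?_⟩
      rintro (rfl | rfl)
      · exact hrefl hZ
      · exact (hnsep hs hY).2
  · intro J hJ
    by_contra hJfin
    -- The exchange of one element of `X` gives a set with a finite symmetric difference to `X`.
    have hZ := (internalPerm_swap hc a b).image_mem_bicardClass hc hX hXX
    have hmem (x : M) := mem_swap_image (x := x) ha hb
    have hfinite : (symmDiff X (Equiv.swap a b '' X)).Finite := by
      refine (Set.toFinite {a, b}).subset fun x hx => ?_
      simp only [Set.mem_symmDiff, hmem] at hx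
      simp only [Set.mem_insert_iff, Set.mem_singleton_iff]
      grind
    have hneg : 𝓜.Negligible (symmDiff X (Equiv.swap a b '' X)) J :=
      .inr (triLT_of_finite_of_infinite hc (hX.symmDiff hZ.1 hc) hfinite hJfin)
    have hEX : E X (Equiv.swap a b '' X) := by
      rcases hJ.2 with ⟨-, h⟩ | ⟨-, h⟩
      · exact (h X hXX _ hZ).2 hneg
      · exact (h X hXX _ hZ).2 (.inl hneg)
    rcases hpair hXX hZ hEX with h | h
    · exact hb (h ▸ (hmem b).2 fun h => absurd rfl h)
    · rw [h, hcompl] at hfinite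
      exact hJfin (hfinite.subset (Set.subset_univ J))
  · rintro ⟨hs, -⟩ Y hY
    ext Z
    rw [sliceClass, bicardClass_eq hc hX hY]
    constructor
    · exact fun h => hsep hs hY h.1 h.2
    · rintro rfl
      exact ⟨hY, hrefl hY⟩
  · rintro ⟨-, hs, -⟩ Y hY
    ext Z
    rw [sliceClass, bicardClass_eq hc hX hY]
    constructor
    · exact fun h => hpair hY h.1 h.2
    · rintro (rfl | rfl)
      · exact ⟨hY, hrefl hY⟩
      · exact hnsep hs hY
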